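/- Let $\mathbb{K}$ be one of the four normed division algebras $\mathbb{R},\mathbb{C},\mathbb{H},\mathbb{O}$, with conjugation $*$ and real part $\mathrm{Re}(a)=\tfrac12(a+a^*)$, and let $D=\dim_{\mathbb{R}}\mathbb{K}+3$, so that $D=4,5,7,11$ respectively. For a hermitian $2\times2$ matrix $A$ over $\mathbb{K}$ put $\tilde A=A-(\mathrm{tr}\,A)1$, and let $$\mathcal{V}=\Big\{\begin{pmatrix}a1&\tilde A\\A&-a1\end{pmatrix} : a\in\mathbb{R},\ A\in\mathfrak{h}_2(\mathbb{K})\Big\}\subseteq\mathbb{K}[4],\qquad \mathcal{S}=\mathbb{K}^4 .$$ The space $\mathcal{V}$ carries the Minkowski metric $h(\mathcal{A},\mathcal{B})=\tfrac14\mathrm{Re}\,\mathrm{tr}(\mathcal{A}\mathcal{B})$, for which $h(\mathcal{A},\mathcal{A})=-\det A+a^2$. Left multiplication of vectors on spinors, $\Gamma(\mathcal{A})\Psi=\mathcal{A}\Psi$, extends to an action of the Clifford algebra of $(\mathcal{V},h)$ on $\mathcal{S}$. Let $\langle\Psi,\Phi\rangle=\mathrm{Re}(\Psi^\dagger\Gamma^0\Phi)$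 with $\Gamma^0=\begin{pmatrix}0&-1\\1&0\end{pmatrix}$, and let $\Psi\cdot\Phi\in\mathcal{V}$ be the unique vector with $h(\Psi\cdot\Phi,\mathcal{A})=\langle\Psi,\mathcal{A}\Phi\rangle$ for all $\mathcal{A}\in\mathcal{V}$. The supertranslation algebra is the real Lie superalgebra $\mathcal{T}=\mathcal{V}\oplus\mathcal{S}$ with even part $\mathcal{V}$ and odd part $\mathcal{S}$, in which the bracket of two spinors is $[\Psi,\Phi]=\Psi\cdot\Phi$ and all brackets that involve a vector are zero. The $n$-cochains $C^n(\mathcal{T},\mathbb{R})$ are the super-skew-symmetric $n$-linear maps from $\mathcal{T}$ to the trivial representation $\mathbb{R}$, with the Chevalley–Eilenberg coboundary, given on homogeneous elements by $$d\omega(X_1,\dots,X_{n+1})=\sum_{i<j}(-1)^{i+j}(-1)^{|X_i||X_j|}\epsilon(i)\,\epsilon(j)\,\omega([X_i,X_j],X_1,\dots,\hat X_i,\dots,\hat X_j,\dots,X_{n+1}),\qquad \epsilon(j)=(-1)^{|X_j|(|X_1|+\cdots+|X_{j-1}|)} .$$ A cochain is a $(p,q)$-form if it vanishes on homogeneous arguments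 unless exactly $p$ of them are vectors and $q$ are spinors. **Theorem.** In each of the dimensions $D=4,5,7,11$ we have $\dim_{\mathbb{R}}\mathcal{V}=D$, and there is a unique $(2,2)$-form $\beta\in C^4(\mathcal{T},\mathbb{R})$ with $$\beta(\Psi,\Phi,\mathcal{A},\mathcal{B})=\langle\Psi,(\mathcal{A}\mathcal{B}-\mathcal{B}\mathcal{A})\Phi\rangle\qquad(\Psi,\Phi\in\mathcal{S},\ \mathcal{A},\mathcal{B}\in\mathcal{V}),$$ where the commutator is taken in the Clifford algebra of $(\mathcal{V},h)$. This $\beta$ is even and is a nontrivial cocycle: $d\beta=0$, and there is no $\theta\in C^3(\mathcal{T},\mathbb{R})$ with $\beta=d\theta$. -/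

import Mathlib

open scoped Quaternion

/-! ### Normed division algebras -/

namespace SuperMinkowski

/-- A (possibly nonassociative) unital real algebra with a conjugation `star`, a real part `re` with
`a + a* = 2 Re(a)`, and a norm `|a|² = Re(a* a)` that is positive definite and multiplicative. -/
class NormedDivisionAlgebra (K : Type) extends NonAssocRing K, StarRing K, Module ℝ K,
    IsScalarTower ℝ K K, SMulCommClass ℝ K K, StarModule ℝ K, Module.Finite ℝ K where
  re : K →ₗ[ℝ] ℝ
  add_star_self : ∀ a : K, a + star a = (2 * re a) • (1 : K)
  re_one : re 1 = 1
  re_mul_assoc : ∀ a b c : K, re ((a * b) * c) = re (a * (b * c))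
  star_mul_mul : ∀ a b : K, star a * (a * b) = re (star a * a) • b
  normSq_pos : ∀ a : K, a ≠ 0 → 0 < re (star a * a)
  normSq_mul : ∀ a b : K,
    re (star (a * b) * (a * b)) = re (star a * a) * re (star b * b)

/-- The octonions, by the Cayley–Dickson construction from Hamilton's quaternions. -/
def Octonion : Type := ℍ[ℝ] × ℍ[ℝ]

namespace Octonion

noncomputable instance : AddCommGroup Octonion := inferInstanceAs (AddCommGroup (ℍ[ℝ] × ℍ[ℝ]))

noncomputable instance : Module ℝ Octonion := inferInstanceAs (Module ℝ (ℍ[ℝ] × ℍ[ℝ]))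

instance : Module.Finite ℝ Octonion := inferInstanceAs (Module.Finite ℝ (ℍ[ℝ] × ℍ[ℝ]))

noncomputable instance : Mul Octonion :=
  ⟨fun x y => (x.1 * y.1 - star y.2 * x.2, y.2 * x.1 + x.2 * star y.1)⟩

noncomputable instance : One Octonion := ⟨((1 : ℍ[ℝ]), (0 : ℍ[ℝ]))⟩

noncomputable instance : Star Octonion := ⟨fun x => (star x.1, -x.2)⟩

@[ext] theorem ext' {x y : Octonion} (h₁ : x.1 = y.1) (h₂ : x.2 = y.2) : x = y := Prod.ext h₁ h₂

@[simp] theorem add_fst (x y : Octonion) : (x + y).1 = x.1 + y.1 := rfl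
@[simp] theorem add_snd (x y : Octonion) : (x + y).2 = x.2 + y.2 := rfl
@[simp] theorem zero_fst : (0 : Octonion).1 = 0 := rfl
@[simp] theorem zero_snd : (0 : Octonion).2 = 0 := rfl
@[simp] theorem one_fst : (1 : Octonion).1 = 1 := rfl
@[simp] theorem one_snd : (1 : Octonion).2 = 0 := rfl
@[simp] theorem smul_fst (r : ℝ) (x : Octonion) : (r • x).1 = r • x.1 := rfl
@[simp] theorem smul_snd (r : ℝ) (x : Octonion) : (r • x).2 = r • x.2 := rfl
@[simp] theorem star_fst (x : Octonion) : (star x).1 = star x.1 := rfl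
@[simp] theorem star_snd (x : Octonion) : (star x).2 = -x.2 := rfl
@[simp] theorem mul_fst (x y : Octonion) : (x * y).1 = x.1 * y.1 - star y.2 * x.2 := rfl
@[simp] theorem mul_snd (x y : Octonion) : (x * y).2 = y.2 * x.1 + x.2 * star y.1 := rfl

noncomputable instance : NonAssocRing Octonion where
  left_distrib x y z := by ext1 <;> simp [mul_add, add_mul] <;> abel
  right_distrib x y z := by ext1 <;> simp [mul_add, add_mul] <;> abel
  zero_mul x := by ext1 <;> simp
  mul_zero x := by ext1 <;> simp
  one_mul x := by ext1 <;> simp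
  mul_one x := by ext1 <;> simp

/-- The real part of an octonion. -/
noncomputable def reLin : Octonion →ₗ[ℝ] ℝ where
  toFun x := x.1.re
  map_add' _ _ := by simp
  map_smul' _ _ := by simp

@[simp] theorem reLin_apply (x : Octonion) : reLin x = x.1.re := rfl

end Octonion

noncomputable instance : NormedDivisionAlgebra Octonion where
  star_involutive x := by ext1 <;> simp
  star_mul x y := by
    ext1 <;> simp
  star_add x y := by ext1 <;> simp <;> abel
  smul_assoc r x y := by ext1 <;> simp [smul_sub, smul_add]
  smul_comm r x y := by ext1 <;> simp [smul_sub, smul_add]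
  star_smul r x := by ext1 <;> simp
  fg_top := (inferInstance : Module.Finite ℝ Octonion).fg_top
  re := Octonion.reLin
  add_star_self x := by ext <;> simp <;> ring
  re_one := by simp
  re_mul_assoc x y z := by simp; ring
  star_mul_mul x y := by ext <;> simp <;> ring
  normSq_pos x hx := by
    have h : Octonion.reLin (star x * x)
        = Quaternion.normSq x.1 + Quaternion.normSq x.2 := by
      simp [Quaternion.normSq_def']; ring
    rw [h]
    have h₁ := Quaternion.normSq_nonneg (a := x.1)
    have h₂ := Quaternion.normSq_nonneg (a := x.2)
    refine lt_of_le_of_ne (add_nonneg h₁ h₂) fun h₀ => hx ?_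
    have h₃ : Quaternion.normSq x.1 = 0 := by linarith
    have h₄ : Quaternion.normSq x.2 = 0 := by linarith
    exact Octonion.ext' (Quaternion.normSq_eq_zero.1 h₃) (Quaternion.normSq_eq_zero.1 h₄)
  normSq_mul x y := by simp; ring

noncomputable instance : NormedDivisionAlgebra ℝ where
  star_smul := star_smul
  re := LinearMap.id
  add_star_self a := by simp; ring
  re_one := rfl
  re_mul_assoc a b c := by simp [mul_assoc]
  star_mul_mul a b := by simp; ring
  normSq_pos a ha := by simpa using mul_self_pos.2 ha
  normSq_mul a b := by simp; ring

noncomputable instance : NormedDivisionAlgebra ℂ where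
  star_smul := star_smul
  re := Complex.reLm
  add_star_self a := by apply Complex.ext <;> simp; ring
  re_one := rfl
  re_mul_assoc a b c := by simp [mul_assoc]
  star_mul_mul a b := by apply Complex.ext <;> simp <;> ring
  normSq_pos a ha := by
    simpa [Complex.normSq_apply] using Complex.normSq_pos.2 ha
  normSq_mul a b := by simp; ring

/-- The real part of a quaternion. -/
def quaternionRe : ℍ[ℝ] →ₗ[ℝ] ℝ where
  toFun x := x.re
  map_add' x y := Quaternion.re_add x y
  map_smul' r x := Quaternion.re_smul x r

@[simp] theorem quaternionRe_apply (x : ℍ[ℝ]) : quaternionRe x = x.re := rfl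

noncomputable instance : NormedDivisionAlgebra ℍ[ℝ] where
  star_smul r x := by ext <;> simp
  re := quaternionRe
  add_star_self a := by ext <;> simp; ring
  re_one := by simp
  re_mul_assoc a b c := by simp [mul_assoc]
  star_mul_mul a b := by ext <;> simp <;> ring
  normSq_pos a ha := by
    have h : quaternionRe (star a * a) = Quaternion.normSq a := by
      simp [Quaternion.normSq_def']; ring
    rw [h]
    exact lt_of_le_of_ne Quaternion.normSq_nonneg
      fun h₀ => ha (Quaternion.normSq_eq_zero.1 h₀.symm)
  normSq_mul a b := by simp; ring

/-- `IsSpacetimeAlgebra D K` says that `K` is the one of the four normed division algebras `ℝ`, `ℂ`,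
`ℍ`, `𝕆` that belongs to the spacetime dimension `D = dim K + 3`. -/
inductive IsSpacetimeAlgebra : (D : ℕ) → (K : Type) → [NormedDivisionAlgebra K] → Prop
  | real : IsSpacetimeAlgebra 4 ℝ
  | complex : IsSpacetimeAlgebra 5 ℂ
  | quaternion : IsSpacetimeAlgebra 7 ℍ[ℝ]
  | octonion : IsSpacetimeAlgebra 11 Octonion

namespace NormedDivisionAlgebra

variable {K : Type} [NormedDivisionAlgebra K]

theorem star_eq (a : K) : star a = (2 * re a) • (1 : K) - a := by
  rw [← add_star_self, add_sub_cancel_left]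

theorem re_star (a : K) : re (star a) = re a := by
  rw [star_eq]; simp [re_one]; ring

theorem re_mul_comm (a b : K) : re (a * b) = re (b * a) := by
  have h : re (a * b) = re (star b * star a) := by rw [← star_mul, re_star]
  rw [h, star_eq, star_eq]
  simp [sub_mul, mul_sub, re_one]; ring

theorem eq_re_smul_one {a : K} (h : star a = a) : a = re a • (1 : K) := by
  have := add_star_self a
  rw [h, ← two_smul ℝ, mul_smul] at this
  exact smul_right_injective K (two_ne_zero (α := ℝ)) this

end NormedDivisionAlgebra

/-! ### Vectors, spinors and the Clifford action in `dim K + 3` dimensions -/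

open NormedDivisionAlgebra

section Vectors

variable (K : Type) [NormedDivisionAlgebra K]

/-- The space `𝔥₂(K)` of hermitian `2 × 2` matrices with entries in `K`. -/
def hermitian2 : Submodule ℝ (Matrix (Fin 2) (Fin 2) K) where
  carrier := {A | A.conjTranspose = A}
  add_mem' {A B} hA hB := by
    simp only [Set.mem_ofPred_eq] at *
    rw [Matrix.conjTranspose_add, hA, hB]
  zero_mem' := by simp
  smul_mem' r A hA := by
    simp only [Set.mem_ofPred_eq] at *
    rw [Matrix.conjTranspose_smul, hA]; simp

variable {K}

/-- Trace reversal `A ↦ A - tr(A) 1`. -/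
def traceReversal (A : Matrix (Fin 2) (Fin 2) K) : Matrix (Fin 2) (Fin 2) K :=
  A - Matrix.diagonal fun _ => A.trace

/-- The `4 × 4` matrix with blocks `a 1`, `Ã`, `A`, `-a 1`. -/
def blockMatrix (a : ℝ) (A : Matrix (Fin 2) (Fin 2) K) :
    Matrix (Fin 2 ⊕ Fin 2) (Fin 2 ⊕ Fin 2) K :=
  Matrix.fromBlocks (a • 1) (traceReversal A) A (-(a • 1))

variable (K)

/-- The space `𝒱` of vectors of Minkowski spacetime. -/
def Vectors : Submodule ℝ (Matrix (Fin 2 ⊕ Fin 2) (Fin 2 ⊕ Fin 2) K) where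
  carrier := {M | ∃ a : ℝ, ∃ A ∈ hermitian2 K, M = blockMatrix a A}
  add_mem' := by
    rintro _ _ ⟨a, A, hA, rfl⟩ ⟨b, B, hB, rfl⟩
    refine ⟨a + b, A + B, add_mem hA hB, ?_⟩
    rw [blockMatrix, blockMatrix, blockMatrix, Matrix.fromBlocks_add]
    congr 1
    · rw [add_smul]
    · ext i j; by_cases h : i = j <;> simp [traceReversal, Matrix.diagonal, h]; abel
    · rw [add_smul, neg_add]
  zero_mem' := ⟨0, 0, zero_mem _, by
    ext i j; rcases i with i | i <;> rcases j with j | j <;>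
      simp [blockMatrix, traceReversal]⟩
  smul_mem' := by
    rintro r _ ⟨a, A, hA, rfl⟩
    refine ⟨r * a, r • A, Submodule.smul_mem _ r hA, ?_⟩
    rw [blockMatrix, blockMatrix, Matrix.fromBlocks_smul]
    congr 1
    · rw [mul_smul]
    · ext i j; by_cases h : i = j <;>
        simp [traceReversal, Matrix.diagonal, h, smul_sub]
    · rw [mul_smul, smul_neg]

/-- The space `𝒮 = S₊ ⊕ S₋ = K⁴` of spinors. -/
abbrev Spinors : Type := Fin 2 ⊕ Fin 2 → K

variable {K}

/-- The Minkowski metric `h(𝒜, ℬ) = ¼ Re tr(𝒜ℬ)` on vectors; see `metric_self`. -/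
noncomputable def metric : LinearMap.BilinForm ℝ (Vectors K) :=
  LinearMap.mk₂ ℝ
    (fun M N => (1 / 4 : ℝ) *
      re ((M : Matrix (Fin 2 ⊕ Fin 2) (Fin 2 ⊕ Fin 2) K) *
        (N : Matrix (Fin 2 ⊕ Fin 2) (Fin 2 ⊕ Fin 2) K)).trace)
    (fun M M' N => by simp [Matrix.add_mul, mul_add])
    (fun r M N => by simp; ring)
    (fun M N N' => by simp [mul_add])
    (fun r M N => by simp; ring)

/-- Every hermitian `2 × 2` matrix has the form `(t + x, y; y*, t - x)`. -/
theorem exists_of_mem_hermitian2 {A : Matrix (Fin 2) (Fin 2) K} (hA : A ∈ hermitian2 K) :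
    ∃ (t x : ℝ) (y : K), A = !![(t + x) • 1, y; star y, (t - x) • 1] := by
  have h : ∀ i j, star (A j i) = A i j := fun i j => by
    conv_rhs => rw [← show A.conjTranspose = A from hA]
    rfl
  refine ⟨(re (A 0 0) + re (A 1 1)) / 2, (re (A 0 0) - re (A 1 1)) / 2, A 0 1, ?_⟩
  ext i j
  fin_cases i <;> fin_cases j
  · simpa [show (re (A 0 0) + re (A 1 1)) / 2 + (re (A 0 0) - re (A 1 1)) / 2 = re (A 0 0) by ring]
      using eq_re_smul_one (h 0 0)
  · simp
  · simpa using (h 1 0).symm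
  · simpa [show (re (A 0 0) + re (A 1 1)) / 2 - (re (A 0 0) - re (A 1 1)) / 2 = re (A 1 1) by ring]
      using eq_re_smul_one (h 1 1)

theorem mem_hermitian2 (t x : ℝ) (y : K) :
    !![(t + x) • 1, y; star y, (t - x) • 1] ∈ hermitian2 K := by
  show Matrix.conjTranspose _ = _
  ext i j
  fin_cases i <;> fin_cases j <;> simp

theorem traceReversal_eq (t x : ℝ) (y : K) :
    traceReversal !![(t + x) • 1, y; star y, (t - x) • 1] =
      !![(-t + x) • 1, y; star y, (-t - x) • 1] := by
  ext i j
  fin_cases i <;> fin_cases j <;>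
    simp [traceReversal, Matrix.trace_fin_two] <;> module

/-- The vector with the components `a`, `t`, `x`, `y`. -/
def vec (a t x : ℝ) (y : K) : Vectors K :=
  ⟨blockMatrix a !![(t + x) • 1, y; star y, (t - x) • 1], a, _, mem_hermitian2 t x y, rfl⟩

theorem exists_vec (M : Vectors K) : ∃ (a t x : ℝ) (y : K), M = vec a t x y := by
  obtain ⟨_, a, A, hA, rfl⟩ := M
  obtain ⟨t, x, y, rfl⟩ := exists_of_mem_hermitian2 hA
  exact ⟨a, t, x, y, rfl⟩

theorem metric_vec (a t x a' t' x' : ℝ) (y y' : K) :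
    metric (vec a t x y) (vec a' t' x' y') = a * a' - t * t' + x * x' + re (star y * y') := by
  have h₁ : re (y * star y') = re (star y * y') := by
    rw [star_eq, star_eq]
    simp [sub_mul, mul_sub]; ring
  simp only [metric, LinearMap.mk₂_apply, vec, blockMatrix, traceReversal_eq,
    Matrix.fromBlocks_multiply]
  simp [Matrix.trace, Fintype.sum_sum_type, re_one, h₁]
  ring

/-- The metric extends the Minkowski metric `-det` of `𝔥₂(K)` by one spatial dimension. -/
theorem metric_self (M : Vectors K) (a : ℝ) (A : Matrix (Fin 2) (Fin 2) K)
    (hA : A ∈ hermitian2 K) (hM : (M : Matrix _ _ K) = blockMatrix a A) :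
    metric M M = -re (A 0 0 * A 1 1 - A 0 1 * A 1 0) + a ^ 2 := by
  obtain ⟨t, x, y, rfl⟩ := exists_of_mem_hermitian2 hA
  obtain rfl : M = vec a t x y := Subtype.ext hM
  rw [metric_vec]
  simp [re_one, re_mul_comm y (star y)]
  ring

theorem metric_separatingLeft (M : Vectors K) (hM : ∀ N, metric M N = 0) : M = 0 := by
  obtain ⟨a, t, x, y, rfl⟩ := exists_vec M
  have h := hM (vec a (-t) x y)
  rw [metric_vec] at h
  have hy₀ : 0 ≤ re (star y * y) := by
    by_cases hy : y = 0
    · simp [hy]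
    · exact (normSq_pos y hy).le
  have hy : y = 0 := by
    by_contra hy
    nlinarith [normSq_pos y hy, mul_self_nonneg a, mul_self_nonneg t, mul_self_nonneg x]
  have ha : a = 0 := by
    nlinarith [mul_self_nonneg a, mul_self_nonneg t, mul_self_nonneg x]
  have ht : t = 0 := by
    nlinarith [mul_self_nonneg a, mul_self_nonneg t, mul_self_nonneg x]
  have hx : x = 0 := by
    nlinarith [mul_self_nonneg a, mul_self_nonneg t, mul_self_nonneg x]
  subst hy ha ht hx
  apply Subtype.ext
  ext i j
  rcases i with i | i <;> rcases j with j | j <;> fin_cases i <;> fin_cases j <;>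
    simp [vec, blockMatrix, traceReversal]

theorem metric_comm (M N : Vectors K) : metric M N = metric N M := by
  obtain ⟨a, t, x, y, rfl⟩ := exists_vec M
  obtain ⟨a', t', x', y', rfl⟩ := exists_vec N
  rw [metric_vec, metric_vec, ← re_star (star y * y'), star_mul, star_star]
  ring

theorem metric_nondegenerate : (metric (K := K)).Nondegenerate :=
  ⟨metric_separatingLeft, fun N hN => metric_separatingLeft N fun M => by
    rw [metric_comm]; exact hN M⟩

/-- The map `Γ`: vectors act on spinors by left multiplication. -/
def gamma : Vectors K →ₗ[ℝ] Module.End ℝ (Spinors K) :=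
  LinearMap.mk₂ ℝ (fun M Ψ => (M : Matrix (Fin 2 ⊕ Fin 2) (Fin 2 ⊕ Fin 2) K).mulVec Ψ)
    (fun M M' Ψ => by simp [Matrix.add_mulVec])
    (fun r M Ψ => by simp [Matrix.smul_mulVec])
    (fun M Ψ Φ => by simp [Matrix.mulVec_add])
    (fun r M Ψ => by simp [Matrix.mulVec_smul])

theorem gamma_apply (M : Vectors K) (Ψ : Spinors K) :
    gamma M Ψ = (M : Matrix (Fin 2 ⊕ Fin 2) (Fin 2 ⊕ Fin 2) K).mulVec Ψ := rfl

variable (K) in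
/-- The quadratic form of the Minkowski metric. -/
noncomputable def metricForm : QuadraticForm ℝ (Vectors K) :=
  LinearMap.BilinMap.toQuadraticMap metric

theorem mul_star_mul (a b : K) : a * (star a * b) = re (star a * a) • b := by
  have h := star_mul_mul (star a) b
  rwa [star_star, re_mul_comm a] at h

theorem gamma_gamma (M : Vectors K) (Ψ : Spinors K) :
    gamma M (gamma M Ψ) = metric M M • Ψ := by
  obtain ⟨a, t, x, y, rfl⟩ := exists_vec M
  rw [metric_vec, gamma_apply, gamma_apply]
  ext i
  simp only [vec, blockMatrix, traceReversal_eq]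
  rcases i with i | i <;> fin_cases i <;>
    simp [Matrix.mulVec, dotProduct, Fintype.sum_sum_type, mul_add, mul_smul_comm, star_mul_mul,
      mul_star_mul]
      <;> module

theorem gamma_mul_self (M : Vectors K) :
    gamma M * gamma M = algebraMap ℝ (Module.End ℝ (Spinors K)) (metricForm K M) := by
  exact LinearMap.ext fun Ψ => gamma_gamma M Ψ

/-- The action of the Clifford algebra of `𝒱` on spinors. -/
noncomputable def cliffordAction :
    CliffordAlgebra (metricForm K) →ₐ[ℝ] Module.End ℝ (Spinors K) :=
  CliffordAlgebra.lift (metricForm K) ⟨gamma (K := K), fun M => gamma_mul_self M⟩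

/-- The commutator `𝒜ℬ - ℬ𝒜` of two vectors in the Clifford algebra of `𝒱`. -/
noncomputable def cliffordCommutator (A B : Vectors K) : CliffordAlgebra (metricForm K) :=
  CliffordAlgebra.ι (metricForm K) A * CliffordAlgebra.ι (metricForm K) B -
    CliffordAlgebra.ι (metricForm K) B * CliffordAlgebra.ι (metricForm K) A

/-- The matrix `Γ⁰` with blocks `0`, `-1`, `1`, `0`. -/
def gammaZero : Matrix (Fin 2 ⊕ Fin 2) (Fin 2 ⊕ Fin 2) K := Matrix.fromBlocks 0 (-1) 1 0

/-- The pairing `⟨Ψ, Φ⟩ = Re(Ψ† Γ⁰ Φ)` of spinors. -/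
def spinorForm : LinearMap.BilinForm ℝ (Spinors K) :=
  LinearMap.mk₂ ℝ (fun Ψ Φ => re (dotProduct (star Ψ) (gammaZero.mulVec Φ)))
    (fun Ψ Ψ' Φ => by simp)
    (fun r Ψ Φ => by simp [star_smul])
    (fun Ψ Φ Φ' => by simp [Matrix.mulVec_add])
    (fun r Ψ Φ => by simp [Matrix.mulVec_smul])

/-- The linear form `𝒜 ↦ ⟨Ψ, Γ(𝒜) Φ⟩` on vectors, bilinear in `Ψ` and `Φ`. -/
def spinorCurrent : Spinors K →ₗ[ℝ] Spinors K →ₗ[ℝ] Module.Dual ℝ (Vectors K) :=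
  LinearMap.mk₂ ℝ (fun Ψ Φ => (spinorForm Ψ).comp (gamma.flip Φ))
    (fun Ψ Ψ' Φ => by ext; simp)
    (fun r Ψ Φ => by ext; simp)
    (fun Ψ Φ Φ' => by ext; simp)
    (fun r Ψ Φ => by ext; simp)

/-- The operation `Ψ · Φ`: the vector with `h(Ψ · Φ, 𝒜) = ⟨Ψ, Γ(𝒜) Φ⟩` for all vectors `𝒜`. -/
noncomputable def spinorDot : Spinors K →ₗ[ℝ] Spinors K →ₗ[ℝ] Vectors K :=
  spinorCurrent.compr₂ (metric.toDual metric_nondegenerate).symm.toLinearMap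

theorem metric_spinorDot (Ψ Φ : Spinors K) (M : Vectors K) :
    metric (spinorDot Ψ Φ) M = spinorForm Ψ (gamma M Φ) := by
  have h := LinearMap.BilinForm.apply_toDual_symm_apply (B := metric (K := K))
    (hB := metric_nondegenerate) (spinorCurrent Ψ Φ) M
  exact h

theorem spinorForm_gamma_comm (Ψ Φ : Spinors K) (M : Vectors K) :
    spinorForm Ψ (gamma M Φ) = spinorForm Φ (gamma M Ψ) := by
  obtain ⟨a, t, x, y, rfl⟩ := exists_vec M
  have h₁ : ∀ p q : K, re (star p * q) = re (star q * p) := fun p q => by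
    rw [← re_star, star_mul, star_star]
  have h₂ : ∀ p q : K, re (star p * (star y * q)) = re (star q * (y * p)) := fun p q => by
    rw [← re_star, star_mul, star_mul, star_star, star_star, re_mul_assoc]
  simp only [spinorForm, LinearMap.mk₂_apply, gamma_apply, vec, blockMatrix, traceReversal_eq,
    gammaZero]
  simp [Matrix.mulVec, dotProduct, Fintype.sum_sum_type, mul_add, mul_smul_comm, h₂]
  linear_combination -(t + x) * h₁ (Ψ (.inl 0)) (Φ (.inl 0)) - (t - x) * h₁ (Ψ (.inl 1)) (Φ (.inl 1))
    + a * h₁ (Ψ (.inl 0)) (Φ (.inr 0)) + a * h₁ (Ψ (.inl 1)) (Φ (.inr 1))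
    + a * h₁ (Ψ (.inr 0)) (Φ (.inl 0)) + a * h₁ (Ψ (.inr 1)) (Φ (.inl 1))
    + (-t + x) * h₁ (Ψ (.inr 0)) (Φ (.inr 0)) + (-t - x) * h₁ (Ψ (.inr 1)) (Φ (.inr 1))

theorem spinorDot_comm (Ψ Φ : Spinors K) : spinorDot Ψ Φ = spinorDot Φ Ψ := by
  rw [← sub_eq_zero]
  refine metric_separatingLeft _ fun M => ?_
  rw [map_sub, LinearMap.sub_apply, metric_spinorDot, metric_spinorDot, spinorForm_gamma_comm,
    sub_self]

end Vectors

/-! ### Lie superalgebras and their cohomology with trivial coefficients -/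

/-- The sign `(-1)^(ij)` of parities `i` and `j`. -/
def koszul (i j : ZMod 2) : ℝ := (-1) ^ (i.val * j.val)

/-- A real Lie superalgebra: the even part is `part 0`, the odd part is `part 1`. -/
class LieSuperalgebra (L : Type*) [AddCommGroup L] [Module ℝ L] where
  part : ZMod 2 → Submodule ℝ L
  isCompl : IsCompl (part 0) (part 1)
  bracket : L →ₗ[ℝ] L →ₗ[ℝ] L
  bracket_mem : ∀ {i j : ZMod 2} {x y : L}, x ∈ part i → y ∈ part j → bracket x y ∈ part (i + j)
  bracket_skew : ∀ {i j : ZMod 2} {x y : L}, x ∈ part i → y ∈ part j →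
    bracket x y = -(koszul i j • bracket y x)
  jacobi : ∀ {i j k : ZMod 2} {x y z : L}, x ∈ part i → y ∈ part j → z ∈ part k →
    bracket x (bracket y z) = bracket (bracket x y) z + koszul i j • bracket y (bracket x z)

section Cohomology

open LieSuperalgebra

variable (L : Type*) [AddCommGroup L] [Module ℝ L] [LieSuperalgebra L]

/-- The `n`-cochains `Cⁿ(L, ℝ)`: super-skew-symmetric `n`-linear maps. Exchanging two adjacent
homogeneous arguments of parities `i` and `j` multiplies the value by `-(-1)^(ij)`. -/
def Cochain (n : ℕ) : Submodule ℝ (MultilinearMap ℝ (fun _ : Fin n => L) ℝ) where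
  carrier := {ω | ∀ (p : Fin n → ZMod 2) (X : Fin n → L), (∀ k, X k ∈ part (p k)) →
    ∀ i j : Fin n, (i : ℕ) + 1 = j →
      ω (X ∘ Equiv.swap i j) = -(koszul (p i) (p j) * ω X)}
  add_mem' {ω η} hω hη p X hX i j hij := by
    rw [add_apply, add_apply, hω p X hX i j hij, hη p X hX i j hij]
    ring
  zero_mem' p X hX i j hij := by simp
  smul_mem' r ω hω p X hX i j hij := by
    rw [smul_apply, smul_apply, hω p X hX i j hij, smul_eq_mul,
      smul_eq_mul]
    ring

variable {L}

/-- The sign of moving the `j`-th of homogeneous elements with parities `p` past all elements before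
it. -/
def moveSign {n : ℕ} (p : Fin n → ZMod 2) (j : Fin n) : ℝ :=
  ∏ k ∈ Finset.univ.filter (· < j), koszul (p j) (p k)

/-- The value of the coboundary `dω` at homogeneous elements `X` with parities `p`:
`∑_{i < j} (-1)^(i+j) (-1)^(|Xᵢ||Xⱼ|) ε(i) ε(j) ω([Xᵢ, Xⱼ], X₀, …, X̂ᵢ, …, X̂ⱼ, …)`,
where `ε(j)` is `moveSign p j`. The terms that involve the action of `L` on the coefficients vanish,
since the coefficients are the trivial representation. -/
def coboundary {n : ℕ} (ω : MultilinearMap ℝ (fun _ : Fin (n + 1) => L) ℝ)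
    (p : Fin (n + 2) → ZMod 2) (X : Fin (n + 2) → L) : ℝ :=
  ∑ j : Fin (n + 2), ∑ i : Fin (n + 1), if i.castSucc < j then
    (-1) ^ ((i : ℕ) + (j : ℕ)) * koszul (p i.castSucc) (p j) *
      moveSign p i.castSucc * moveSign p j *
      ω (Fin.cons (bracket (X i.castSucc) (X j)) (i.removeNth (j.removeNth X)))
  else 0

/-- `ω` is closed, or a cocycle: `dω = 0`. -/
def IsClosedCochain {n : ℕ} (ω : Cochain L (n + 1)) : Prop :=
  ∀ (p : Fin (n + 2) → ZMod 2) (X : Fin (n + 2) → L), (∀ k, X k ∈ part (p k)) →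
    coboundary ω.1 p X = 0

/-- `η` is exact, or a coboundary: `η = dω` for some cochain `ω`. -/
def IsExactCochain {n : ℕ} (η : Cochain L (n + 2)) : Prop :=
  ∃ ω : Cochain L (n + 1), ∀ (p : Fin (n + 2) → ZMod 2) (X : Fin (n + 2) → L),
    (∀ k, X k ∈ part (p k)) → η.1 X = coboundary ω.1 p X

/-- `ω` is even, that is, parity-preserving: it vanishes at homogeneous elements of odd total
parity, because `ℝ` is purely even. -/
def IsEvenCochain {n : ℕ} (ω : Cochain L n) : Prop :=
  ∀ (p : Fin n → ZMod 2) (X : Fin n → L), (∀ k, X k ∈ part (p k)) → ∑ k, p k = 1 → ω.1 X = 0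

/-- `ω` is a `(p, q)`-form: it vanishes at homogeneous elements unless `p` of them are even and `q`
of them are odd. -/
def IsForm (p q : ℕ) (ω : Cochain L (p + q)) : Prop :=
  ∀ (s : Fin (p + q) → ZMod 2) (X : Fin (p + q) → L), (∀ k, X k ∈ part (s k)) →
    (Finset.univ.filter fun k => s k = 1).card ≠ q → ω.1 X = 0

end Cohomology

/-! ### The supertranslation algebra -/

section Supertranslation

variable (K : Type) [NormedDivisionAlgebra K]

/-- The supertranslation algebra `𝒯 = 𝒱 ⊕ 𝒮`. -/
abbrev Supertranslation : Type := Vectors K × Spinors K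

variable {K}

/-- The bracket of the supertranslation algebra: two spinors have the bracket `Ψ · Φ`, all other
brackets are zero. -/
noncomputable def superBracket :
    Supertranslation K →ₗ[ℝ] Supertranslation K →ₗ[ℝ] Supertranslation K :=
  (spinorDot.compl₁₂ (LinearMap.snd ℝ (Vectors K) (Spinors K))
    (LinearMap.snd ℝ (Vectors K) (Spinors K))).compr₂ (LinearMap.inl ℝ (Vectors K) (Spinors K))

theorem superBracket_apply (x y : Supertranslation K) :
    superBracket x y = (spinorDot x.2 y.2, 0) := rfl

/-- The grading: vectors are even, spinors are odd. -/
def superPart (i : ZMod 2) : Submodule ℝ (Supertranslation K) :=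
  if i = 0 then Submodule.prod ⊤ ⊥ else Submodule.prod ⊥ ⊤

theorem mem_superPart_zero {x : Supertranslation K} : x ∈ superPart (K := K) 0 ↔ x.2 = 0 := by
  simp [superPart, Submodule.mem_prod]

theorem mem_superPart_one {x : Supertranslation K} : x ∈ superPart (K := K) 1 ↔ x.1 = 0 := by
  simp [superPart, Submodule.mem_prod]

theorem parity_cases : ∀ i : ZMod 2, i = 0 ∨ i = 1 := by decide

noncomputable instance : LieSuperalgebra (Supertranslation K) where
  part := superPart
  isCompl := by
    rw [isCompl_iff, Submodule.disjoint_def, codisjoint_iff, Submodule.eq_top_iff']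
    refine ⟨fun x h₀ h₁ => Prod.ext (mem_superPart_one.1 h₁) (mem_superPart_zero.1 h₀),
      fun x => ?_⟩
    exact Submodule.mem_sup.2 ⟨(x.1, 0), mem_superPart_zero.2 rfl, (0, x.2),
      mem_superPart_one.2 rfl, by simp⟩
  bracket := superBracket
  bracket_mem {i j x y} hx hy := by
    rw [superBracket_apply]
    obtain rfl | rfl : i = 0 ∨ i = 1 := parity_cases i
    · rw [mem_superPart_zero.1 hx]; simp [← Prod.zero_eq_mk]
    obtain rfl | rfl : j = 0 ∨ j = 1 := parity_cases j
    · rw [mem_superPart_zero.1 hy]; simp [← Prod.zero_eq_mk]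
    exact mem_superPart_zero.2 rfl
  bracket_skew {i j x y} hx hy := by
    rw [superBracket_apply, superBracket_apply]
    obtain rfl | rfl : i = 0 ∨ i = 1 := parity_cases i
    · rw [mem_superPart_zero.1 hx]; simp
    obtain rfl | rfl : j = 0 ∨ j = 1 := parity_cases j
    · rw [mem_superPart_zero.1 hy]; simp
    rw [spinorDot_comm x.2 y.2, show koszul 1 1 = -1 by simp [koszul, ZMod.val_one]]
    simp
  jacobi {i j k x y z} hx hy hz := by
    simp [superBracket_apply]

end Supertranslation

end SuperMinkowski

open SuperMinkowski

/-! On homogeneous arguments dβ can be nonzero only at four spinors and one vector: the bracket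
consumes two spinors and β needs two more. There it is, up to sign, the sum over the six ways to put
two of the spinors into the bracket and leave two in β. This sum is, up to a constant, the
polarization of the quartic ⟨Ψ, [Ψ·Ψ, 𝒜]Ψ⟩, so closedness amounts to the vanishing of the quartic
(`polarize_quartic`). Vectors are skew-adjoint for the skew pairing, which turns the quartic into
-2⟨(Ψ·Ψ)Ψ, 𝒜Ψ⟩. The core is therefore the four-spinor identity Ψ·((Ψ·Ψ)Ψ) = 0,
`spinorForm_gamma_spinorDot_self`. It is a computation in components; as K need not be associative,
it rests on the linearized alternative laws and on the cyclicity and associativity of the real part.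

β is not exact because every term of dθ contains a bracket. Hence dθ vanishes at two spinors with
Ψ·Φ = 0 followed by two vectors, while β takes the value -2 at a suitable choice of these.

Existence and uniqueness are formal: ⟨Ψ, [𝒜, ℬ]Φ⟩ is symmetric in the spinors and skew in the
vectors, so it extends by signed shuffles (`fourForm`), and super-skew-symmetry leaves no other
extension. -/

namespace SuperMinkowski

open NormedDivisionAlgebra LieSuperalgebra

/-! ### Alternative laws in K -/

section
variable {K : Type} [NormedDivisionAlgebra K]

theorem re_star_mul_comm (p q : K) : re (star p * q) = re (star q * p) := by
  rw [← re_star, star_mul, star_star]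

/-- Linearized left alternativity. -/
theorem mul_star_mul_add (a b c : K) :
    a * (star b * c) + b * (star a * c) = (2 * re (star a * b)) • c := by
  have h := mul_star_mul (a + b) c
  simp only [star_add, add_mul, mul_add, map_add, add_smul, mul_star_mul] at h
  rw [re_star_mul_comm b a] at h
  rw [two_mul, add_smul]
  rw [← sub_eq_zero] at h ⊢
  rw [← h]
  abel

/-- Linearized right alternativity. -/
theorem mul_mul_star_add (a b c : K) :
    (c * a) * star b + (c * b) * star a = (2 * re (star a * b)) • c := by
  have h := congrArg star (mul_star_mul_add b a (star c))
  rw [re_star_mul_comm b a] at h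
  simpa using h

/-- The diagonal case of the linearized right alternative law, with the factor 2 cancelled. -/
theorem mul_star_mul_self (u v : K) : (u * star v) * v = re (star v * v) • u := by
  have h := mul_mul_star_add (star v) (star v) u
  rw [star_star, ← two_smul ℝ, mul_smul, re_mul_comm] at h
  exact smul_right_injective K (two_ne_zero (α := ℝ)) h

/-! ### The dimension of the space of vectors -/

theorem finrank_vectors : Module.finrank ℝ (Vectors K) = Module.finrank ℝ K + 3 := by
  let f : (ℝ × ℝ × ℝ × K) →ₗ[ℝ] Vectors K :=
    { toFun := fun v => vec v.1 v.2.1 v.2.2.1 v.2.2.2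
      map_add' := fun v w => by
        apply Subtype.ext
        ext i j
        rcases i with i | i <;> rcases j with j | j <;> fin_cases i <;> fin_cases j <;>
          simp [vec, blockMatrix, traceReversal] <;> module
      map_smul' := fun r v => by
        apply Subtype.ext
        ext i j
        rcases i with i | i <;> rcases j with j | j <;> fin_cases i <;> fin_cases j <;>
          simp [vec, blockMatrix, traceReversal] <;> module }
  have hf : Function.Bijective f := by
    refine ⟨(injective_iff_map_eq_zero f).2 ?_, fun M => ?_⟩
    · rintro ⟨a, t, x, y⟩ h
      have h' : vec a t x y = 0 := h
      -- Pairing with test vectors isolates each coordinate. For `y` the test vector is `y` itself,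
      -- and positive definiteness finishes.
      have key : ∀ a' t' x' y', a * a' - t * t' + x * x' + re (star y * y') = 0 := by
        intro a' t' x' y'
        rw [← metric_vec, h', map_zero, LinearMap.zero_apply]
      have ha : a = 0 := by simpa using key 1 0 0 0
      have ht : t = 0 := by simpa using key 0 1 0 0
      have hx : x = 0 := by simpa using key 0 0 1 0
      have hy : y = 0 := by
        by_contra hy
        exact (normSq_pos y hy).ne' (by simpa using key 0 0 0 y)
      subst ha ht hx hy
      rfl
    · obtain ⟨a, t, x, y, rfl⟩ := exists_vec M
      exact ⟨(a, t, x, y), rfl⟩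
  rw [← (LinearEquiv.ofBijective f hf).finrank_eq]
  simp only [Module.finrank_prod, Module.finrank_self]
  omega

theorem IsSpacetimeAlgebra.finrank_vectors {D : ℕ} (hK : IsSpacetimeAlgebra D K) :
    Module.finrank ℝ (Vectors K) = D := by
  rw [SuperMinkowski.finrank_vectors]
  cases hK
  · rw [show Module.finrank ℝ ℝ = 1 from Module.finrank_self ℝ]
  · rw [show Module.finrank ℝ ℂ = 2 from Complex.finrank_real_complex]
  · rw [show Module.finrank ℝ ℍ[ℝ] = 4 from Quaternion.finrank_eq_four]
  · rw [show Module.finrank ℝ Octonion = 8 from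
      (Module.finrank_prod (R := ℝ) (M := ℍ[ℝ]) (M' := ℍ[ℝ])).trans
        (by rw [Quaternion.finrank_eq_four])]

/-! ### The four-spinor identity -/

/-- The pairing `⟨Ψ, 𝒜Φ⟩` in components. -/
theorem spinorForm_gamma_vec (Ψ Φ : Spinors K) (a t x : ℝ) (y : K) :
    spinorForm Ψ (gamma (vec a t x y) Φ) =
      a * (re (star (Ψ (.inl 0)) * Φ (.inr 0)) + re (star (Ψ (.inl 1)) * Φ (.inr 1)) +
        re (star (Ψ (.inr 0)) * Φ (.inl 0)) + re (star (Ψ (.inr 1)) * Φ (.inl 1))) -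
      (t + x) * (re (star (Ψ (.inl 0)) * Φ (.inl 0)) + re (star (Ψ (.inr 1)) * Φ (.inr 1))) -
      (t - x) * (re (star (Ψ (.inl 1)) * Φ (.inl 1)) + re (star (Ψ (.inr 0)) * Φ (.inr 0))) +
      re (star y * (Ψ (.inr 0) * star (Φ (.inr 1)) + Φ (.inr 0) * star (Ψ (.inr 1)) -
        Ψ (.inl 0) * star (Φ (.inl 1)) - Φ (.inl 0) * star (Ψ (.inl 1)))) := by
  -- Cyclicity and associativity of the real part bring `star y` to the front of every term, so that
  -- comparison with `metric_vec` shows the `y`-component of Ψ·Φ.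
  have h₁ : ∀ p q : K, re (star p * (star y * q)) = re (star y * (q * star p)) := fun p q => by
    rw [re_mul_comm, re_mul_assoc]
  have h₂ : ∀ p q : K, re (star p * (y * q)) = re (star y * (p * star q)) := fun p q => by
    rw [← re_star, star_mul, star_mul, star_star, re_mul_comm, ← re_mul_assoc, re_mul_comm]
  simp only [spinorForm, LinearMap.mk₂_apply, gamma_apply, vec, blockMatrix, traceReversal_eq,
    gammaZero]
  simp [Matrix.mulVec, dotProduct, Fintype.sum_sum_type, mul_add, mul_sub, mul_smul_comm, h₁, h₂]
  ring

/-- The square `Ψ · Ψ` in components. -/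
theorem spinorDot_self (Ψ : Spinors K) :
    spinorDot Ψ Ψ = vec
      (2 * re (star (Ψ (.inl 0)) * Ψ (.inr 0)) + 2 * re (star (Ψ (.inl 1)) * Ψ (.inr 1)))
      (re (star (Ψ (.inl 0)) * Ψ (.inl 0)) + re (star (Ψ (.inl 1)) * Ψ (.inl 1)) +
        re (star (Ψ (.inr 0)) * Ψ (.inr 0)) + re (star (Ψ (.inr 1)) * Ψ (.inr 1)))
      (-re (star (Ψ (.inl 0)) * Ψ (.inl 0)) + re (star (Ψ (.inl 1)) * Ψ (.inl 1)) +
        re (star (Ψ (.inr 0)) * Ψ (.inr 0)) - re (star (Ψ (.inr 1)) * Ψ (.inr 1)))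
      ((2 : ℝ) • (Ψ (.inr 0) * star (Ψ (.inr 1)) - Ψ (.inl 0) * star (Ψ (.inl 1)))) := by
  rw [← sub_eq_zero]
  refine metric_separatingLeft _ fun M => ?_
  obtain ⟨a, t, x, y, rfl⟩ := exists_vec M
  rw [map_sub, LinearMap.sub_apply, metric_spinorDot, spinorForm_gamma_vec, metric_vec,
    re_star_mul_comm _ y, re_star_mul_comm (Ψ (.inr 0)) (Ψ (.inl 0)),
    re_star_mul_comm (Ψ (.inr 1)) (Ψ (.inl 1))]
  simp [mul_add, mul_sub, mul_smul_comm]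
  ring

/-- The spinor `(Ψ · Ψ) Ψ` in components. -/
theorem gamma_spinorDot_self (Ψ : Spinors K) (p q r s : K) (a : ℝ)
    (hp : Ψ (.inl 0) = p) (hq : Ψ (.inl 1) = q) (hr : Ψ (.inr 0) = r) (hs : Ψ (.inr 1) = s)
    (ha : a = re (star p * r) + re (star q * s)) :
    gamma (spinorDot Ψ Ψ) Ψ = (2 : ℝ) •
      Sum.elim ![a • p - re (star p * p) • r - (p * star q) * s,
          a • q - re (star q * q) • s - (q * star p) * r]
        ![re (star r * r) • p + (r * star s) * q - a • r,
          re (star s * s) • q + (s * star r) * p - a • s] := by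
  rw [spinorDot_self]
  ext i
  simp only [vec, blockMatrix, traceReversal_eq, gamma_apply]
  rcases i with i | i <;> fin_cases i <;>
    simp [Matrix.mulVec, dotProduct, Fintype.sum_sum_type, hp, hq, hr, hs, ha, sub_mul, smul_mul_assoc,
      mul_star_mul_self, smul_sub] <;> module

/-- Γ⁰ is real and antisymmetric, and conjugation preserves the real part. -/
theorem spinorForm_comm (Ψ Φ : Spinors K) : spinorForm Ψ Φ = -spinorForm Φ Ψ := by
  simp only [spinorForm, LinearMap.mk₂_apply, gammaZero]
  simp [Matrix.mulVec, dotProduct, Fintype.sum_sum_type, Matrix.one_apply]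
  linear_combination - re_star_mul_comm (Ψ (.inl 0)) (Φ (.inr 0))
    - re_star_mul_comm (Ψ (.inl 1)) (Φ (.inr 1))
    + re_star_mul_comm (Ψ (.inr 0)) (Φ (.inl 0))
    + re_star_mul_comm (Ψ (.inr 1)) (Φ (.inl 1))

/-- Skew-adjointness of vectors: ⟨Ψ, 𝒜Φ⟩ is symmetric in the spinors although the pairing is skew.
-/
theorem spinorForm_gamma_left (Ψ Φ : Spinors K) (M : Vectors K) :
    spinorForm Ψ (gamma M Φ) = -spinorForm (gamma M Ψ) Φ := by
  rw [spinorForm_gamma_comm, spinorForm_comm]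

/-- The spinor `(Ψ · Ψ) Ψ` is annihilated by `Ψ` under the dot product. -/
theorem spinorForm_gamma_spinorDot_self (Ψ : Spinors K) (M : Vectors K) :
    spinorForm (gamma (spinorDot Ψ Ψ) Ψ) (gamma M Ψ) = 0 := by
  obtain ⟨a', t, x, y, rfl⟩ := exists_vec M
  obtain ⟨p, hp⟩ : ∃ p, Ψ (.inl 0) = p := ⟨_, rfl⟩
  obtain ⟨q, hq⟩ : ∃ q, Ψ (.inl 1) = q := ⟨_, rfl⟩
  obtain ⟨r, hr⟩ : ∃ r, Ψ (.inr 0) = r := ⟨_, rfl⟩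
  obtain ⟨s, hs⟩ : ∃ s, Ψ (.inr 1) = s := ⟨_, rfl⟩
  -- This is half the scalar component of Ψ·Ψ; the common factor 2 is pulled out of (Ψ·Ψ)Ψ.
  obtain ⟨a, ha⟩ : ∃ a, a = re (star p * r) + re (star q * s) := ⟨_, rfl⟩
  rw [gamma_spinorDot_self Ψ p q r s a hp hq hr hs ha, map_smul, LinearMap.smul_apply,
    spinorForm_gamma_vec]
  simp only [Sum.elim_inl, Sum.elim_inr, Matrix.cons_val_zero, Matrix.cons_val_one, hp, hq, hr, hs]
  have pair (p q r s : K) : re (star ((p * star q) * s) * r) = re ((q * star p) * (r * star s)) := by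
    rw [star_mul, star_mul, star_star, re_mul_comm, ← re_mul_assoc, re_mul_comm]
  -- These nested products cannot be reassociated. The linearized alternative laws reduce them to
  -- real multiples of `r * star s`, `p * star q`, `r * star q` and `p * star s`, after which `hy`
  -- is linear algebra.
  have e₁ : ((r * star s) * q) * star s = (2 * re (star q * s)) • (r * star s) -
      re (star s * s) • (r * star q) := by
    rw [eq_sub_iff_add_eq, ← mul_mul_star_add q s, mul_star_mul_self, smul_mul_assoc]
  have e₂ : r * (star p * (r * star s)) = (2 * re (star p * r)) • (r * star s) -
      re (star r * r) • (p * star s) := by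
    rw [eq_sub_iff_add_eq, re_star_mul_comm p r, ← mul_star_mul_add r p, star_mul_mul, mul_smul_comm]
  have e₃ : ((p * star q) * s) * star q = (2 * re (star q * s)) • (p * star q) -
      re (star q * q) • (p * star s) := by
    rw [eq_sub_iff_add_eq, re_star_mul_comm q s, ← mul_mul_star_add s q, mul_star_mul_self,
      smul_mul_assoc]
  have e₄ : p * (star r * (p * star q)) = (2 * re (star p * r)) • (p * star q) -
      re (star p * p) • (r * star q) := by
    rw [eq_sub_iff_add_eq, ← mul_star_mul_add p r, star_mul_mul, mul_smul_comm]
  -- The `y`-component of the dot product of ½(Ψ·Ψ)Ψ with Ψ; the three real components remain after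
  -- it.
  have hy : (re (star r * r) • p + (r * star s) * q - a • r) * star s +
      r * star (re (star s * s) • q + (s * star r) * p - a • s) -
      (a • p - re (star p * p) • r - (p * star q) * s) * star q -
      p * star (a • q - re (star q * q) • s - (q * star p) * r) = 0 := by
    simp only [star_sub, star_add, star_smul, star_trivial, star_mul, star_star, add_mul, sub_mul,
      mul_add, mul_sub, smul_mul_assoc, mul_smul_comm, e₁, e₂, e₃, e₄, ha]
    module
  rw [hy]
  simp only [star_sub, star_add, star_smul, star_trivial, sub_mul, add_mul, smul_mul_assoc, map_sub,
    map_add, map_smul, smul_eq_mul, mul_zero, map_zero, pair]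
  -- After `pair`, the products in which a component meets its own conjugate collapse to a squared
  -- norm; the other real parts cancel among themselves.
  have norm (p q s : K) : re ((q * star p) * (p * star s)) = re (star p * p) * re (star q * s) := by
    rw [re_mul_assoc, star_mul_mul, mul_smul_comm, map_smul, smul_eq_mul, ← re_star (q * star s),
      star_mul, star_star, re_mul_comm s]
  simp only [norm, ha, re_star_mul_comm r p, re_star_mul_comm s q, re_mul_comm (s * star r),
    re_mul_comm (r * star s)]
  ring
-- The commutator form and its polarized identity
variable (K) in
/-- The multilinear form `⟨Ψ, (𝒜ℬ - ℬ𝒜) Φ⟩`. -/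
def commutatorForm :
    Spinors K →ₗ[ℝ] Spinors K →ₗ[ℝ] Vectors K →ₗ[ℝ] Vectors K →ₗ[ℝ] ℝ :=
  LinearMap.mk₂ ℝ
    (fun Ψ Φ => LinearMap.mk₂ ℝ
      (fun A B => spinorForm Ψ (gamma A (gamma B Φ) - gamma B (gamma A Φ)))
      (fun A A' B => by simp; ring)
      (fun r A B => by simp; ring)
      (fun A B B' => by simp; ring)
      (fun r A B => by simp; ring))
    (fun Ψ Ψ' Φ => by ext; simp)
    (fun r Ψ Φ => by ext; simp)
    (fun Ψ Φ Φ' => by ext; simp; ring)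
    (fun r Ψ Φ => by ext; simp; ring)

theorem commutatorForm_apply (Ψ Φ : Spinors K) (A B : Vectors K) :
    commutatorForm K Ψ Φ A B = spinorForm Ψ (gamma A (gamma B Φ) - gamma B (gamma A Φ)) := rfl

theorem spinorForm_cliffordCommutator (Ψ Φ : Spinors K) (A B : Vectors K) :
    spinorForm Ψ (cliffordAction (cliffordCommutator A B) Φ) = commutatorForm K Ψ Φ A B := by
  simp [cliffordAction, cliffordCommutator, commutatorForm_apply]

theorem commutatorForm_swap_vectors (Ψ Φ : Spinors K) (A B : Vectors K) :
    commutatorForm K Ψ Φ A B = -commutatorForm K Ψ Φ B A := by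
  simp [commutatorForm_apply]

/-- Moving both vectors to the other spinor reverses their order and costs two signs. The skew
pairing contributes a third, which the commutator absorbs. -/
theorem commutatorForm_swap_spinors (Ψ Φ : Spinors K) (A B : Vectors K) :
    commutatorForm K Ψ Φ A B = commutatorForm K Φ Ψ A B := by
  have h (A B : Vectors K) : spinorForm Ψ (gamma A (gamma B Φ)) =
      -spinorForm Φ (gamma B (gamma A Ψ)) := by
    rw [spinorForm_gamma_left Ψ, spinorForm_comm (gamma A Ψ), spinorForm_gamma_left Φ]
  rw [commutatorForm_apply, commutatorForm_apply, map_sub, map_sub, h, h]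
  ring

/-- The four-spinor identity that makes the supertranslation four-cocycle closed. -/
theorem commutatorForm_spinorDot_self (Ψ : Spinors K) (A : Vectors K) :
    commutatorForm K Ψ Ψ (spinorDot Ψ Ψ) A = 0 := by
  have h := spinorForm_gamma_spinorDot_self Ψ A
  rw [commutatorForm_apply, map_sub, spinorForm_gamma_left Ψ (gamma A Ψ), h,
    spinorForm_gamma_left Ψ (gamma _ Ψ), spinorForm_comm (gamma A Ψ), h]
  simp

/-- Polarization of a quartic identity `T(x, x, D(x, x)) = 0`. -/
theorem polarize_quartic {S V : Type*} [AddCommGroup S] [Module ℝ S] [AddCommGroup V] [Module ℝ V]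
    (T : S →ₗ[ℝ] S →ₗ[ℝ] V →ₗ[ℝ] ℝ) (D : S →ₗ[ℝ] S →ₗ[ℝ] V) (hT : ∀ x y v, T x y v = T y x v)
    (hD : ∀ x y, D x y = D y x) (h : ∀ x, T x x (D x x) = 0) (x y z w : S) :
    T x y (D z w) + T x z (D y w) + T x w (D y z) + T y z (D x w) + T y w (D x z) +
      T z w (D x y) = 0 := by
  -- Half the linear coefficient c₁ of t ↦ T(x+ty, x+ty, D(x+ty, x+ty)). The odd differences at t =
  -- ±1 and t = ±2 are 2c₁ + 2c₃ and 4c₁ + 16c₃; the weights 1/3 and -1/24 eliminate c₃.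
  have h₁ (x y : S) : T x y (D x x) + T x x (D x y) = 0 := by
    have e₁ := h (x + y)
    have e₂ := h (x - y)
    have e₃ := h (x + (2 : ℝ) • y)
    have e₄ := h (x - (2 : ℝ) • y)
    simp only [map_add, map_sub, map_smul, LinearMap.add_apply, LinearMap.sub_apply,
      LinearMap.smul_apply, smul_eq_mul, hT y x, hD y x] at e₁ e₂ e₃ e₄
    linear_combination (e₁ - e₂) / 3 - (e₃ - e₄) / 24
  -- `h₁` is cubic in x. Half its odd difference along z is the linear coefficient plus the cubic
  -- one, and the latter is `h₁ z y`.
  have h₂ (x y z : S) : T y z (D x x) + 2 * T x y (D x z) + 2 * T x z (D x y) +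
      T x x (D y z) = 0 := by
    have e₁ := h₁ (x + z) y
    have e₂ := h₁ (x - z) y
    have e₃ := h₁ z y
    simp only [map_add, map_sub, LinearMap.add_apply, LinearMap.sub_apply, hT z x, hD z x, hT z y,
      hD z y] at e₁ e₂ e₃
    linear_combination (e₁ - e₂) / 2 - e₃
  have e₁ := h₂ (x + w) y z
  have e₂ := h₂ x y z
  have e₃ := h₂ w y z
  simp only [map_add, LinearMap.add_apply, hD w x, hT w x, hT w y, hT w z, hD w y, hD w z] at e₁ e₃
  linear_combination (e₁ - e₂ - e₃) / 2

theorem commutatorForm_spinorDot_polarized (x y z w : Spinors K) (A : Vectors K) :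
    commutatorForm K x y (spinorDot z w) A + commutatorForm K x z (spinorDot y w) A +
      commutatorForm K x w (spinorDot y z) A + commutatorForm K y z (spinorDot x w) A +
      commutatorForm K y w (spinorDot x z) A + commutatorForm K z w (spinorDot x y) A = 0 := by
  -- `polarize_quartic` contracts the last argument, so `A` is put in the slot before it; this
  -- accounts for the overall sign.
  have h := polarize_quartic ((commutatorForm K).compr₂ (LinearMap.applyₗ A)) spinorDot
    (fun x y v => commutatorForm_swap_spinors x y A v) spinorDot_comm
    (fun x => by
      change commutatorForm K x x A (spinorDot x x) = 0
      rw [commutatorForm_swap_vectors, commutatorForm_spinorDot_self, neg_zero]) x y z w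
  simp only [LinearMap.compr₂_apply, LinearMap.applyₗ_apply_apply,
    fun x y v => commutatorForm_swap_vectors x y A v] at h
  linear_combination -h

end

/-! ### Cochains of Lie superalgebras -/

section
variable {L : Type*} [AddCommGroup L] [Module ℝ L] [LieSuperalgebra L]

theorem koszul_zero_left (j : ZMod 2) : koszul 0 j = 1 := by simp [koszul]

theorem koszul_zero_right (i : ZMod 2) : koszul i 0 = 1 := by simp [koszul]

theorem koszul_one_one : koszul 1 1 = -1 := by simp [koszul, ZMod.val_one]

theorem koszul_ne_zero (i j : ZMod 2) : koszul i j ≠ 0 := by simp [koszul]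

/-- A multilinear map that vanishes at homogeneous arguments vanishes. -/
theorem multilinear_eq_zero_of_homogeneous {n : ℕ} (ω : MultilinearMap ℝ (fun _ : Fin n => L) ℝ)
    (h : ∀ (p : Fin n → ZMod 2) (X : Fin n → L), (∀ k, X k ∈ part (p k)) → ω X = 0) :
    ω = 0 := by
  ext X
  have hX : ∀ k, ∃ y ∈ part (L := L) 0, ∃ z ∈ part (L := L) 1, y + z = X k := fun k =>
    Submodule.mem_sup.1 (by rw [isCompl.sup_eq_top]; trivial)
  choose Y hY Z hZ hYZ using hX
  obtain rfl : Y + Z = X := funext hYZ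
  rw [MultilinearMap.map_add_univ]
  refine Finset.sum_eq_zero fun s _ => h (fun k => if k ∈ s then 0 else 1) _ fun k => ?_
  by_cases hk : k ∈ s <;> simp [hk, hY, hZ]

/-- Whether a cochain vanishes at all homogeneous arguments of given parities does not depend on the
order of the parities. -/
theorem vanishes_of_swap {n : ℕ} (ω : Cochain L n) {p q : Fin n → ZMod 2}
    (hq : ∀ X : Fin n → L, (∀ k, X k ∈ part (q k)) → ω.1 X = 0)
    (i j : Fin n) (hij : (i : ℕ) + 1 = j) (hpq : p ∘ Equiv.swap i j = q)
    (X : Fin n → L) (hX : ∀ k, X k ∈ part (p k)) : ω.1 X = 0 := by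
  have h := hq (X ∘ Equiv.swap i j) fun k => by
    rw [← hpq]; exact hX _
  rw [ω.2 p X hX i j hij, neg_eq_zero] at h
  exact (mul_eq_zero.1 h).resolve_left (koszul_ne_zero _ _)

/-- A `(2, 2)`-form is determined by its values at two odd elements followed by two even ones. -/
theorem IsForm.eq_zero {ω : Cochain L 4} (hω : IsForm 2 2 ω)
    (h : ∀ X : Fin 4 → L, (∀ k, X k ∈ part ((![1, 1, 0, 0] : Fin 4 → ZMod 2) k)) → ω.1 X = 0) :
    ω = 0 := by
  -- Adjacent exchanges lead from (1,1,0,0) to all six arrangements of two odd and two even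
  -- parities.
  have h₁ := vanishes_of_swap ω (p := ![1, 0, 1, 0]) h 1 2 rfl (by decide)
  have h₂ := vanishes_of_swap ω (p := ![1, 0, 0, 1]) h₁ 2 3 rfl (by decide)
  have h₃ := vanishes_of_swap ω (p := ![0, 1, 1, 0]) h₁ 0 1 rfl (by decide)
  have h₄ := vanishes_of_swap ω (p := ![0, 1, 0, 1]) h₂ 0 1 rfl (by decide)
  have h₅ := vanishes_of_swap ω (p := ![0, 0, 1, 1]) h₄ 1 2 rfl (by decide)
  refine Subtype.ext (multilinear_eq_zero_of_homogeneous _ fun p X hX => ?_)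
  by_cases hp : (Finset.univ.filter fun k => p k = 1).card = 2
  · have key : ∀ p : Fin 4 → ZMod 2, (Finset.univ.filter fun k => p k = 1).card = 2 →
        p = ![1, 1, 0, 0] ∨ p = ![1, 0, 1, 0] ∨ p = ![1, 0, 0, 1] ∨ p = ![0, 1, 1, 0] ∨
          p = ![0, 1, 0, 1] ∨ p = ![0, 0, 1, 1] := by decide
    rcases key p hp with rfl | rfl | rfl | rfl | rfl | rfl
    · exact h X hX
    · exact h₁ X hX
    · exact h₂ X hX
    · exact h₃ X hX
    · exact h₄ X hX
    · exact h₅ X hX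
  · exact hω p X hX hp

/-- With trivial coefficients every term of dω contains a bracket. This is the obstruction to
exactness. -/
theorem coboundary_eq_zero_of_bracket {n : ℕ} (ω : MultilinearMap ℝ (fun _ : Fin (n + 1) => L) ℝ)
    (p : Fin (n + 2) → ZMod 2) (X : Fin (n + 2) → L) (h : ∀ i j, i < j → bracket (X i) (X j) = 0) :
    coboundary ω p X = 0 := by
  refine Finset.sum_eq_zero fun j _ => Finset.sum_eq_zero fun i _ => ?_
  split_ifs with hij
  · rw [h _ _ hij, ω.map_coord_zero 0 rfl, mul_zero]
  · rfl

section

variable (p : Fin 5 → ZMod 2)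

theorem moveSign_zero : moveSign p 0 = 1 := by
  simp [moveSign]

theorem moveSign_one : moveSign p 1 = koszul (p 1) (p 0) := by
  simp [moveSign, Finset.prod_filter]

theorem moveSign_two : moveSign p 2 = koszul (p 2) (p 0) * koszul (p 2) (p 1) := by
  simp [moveSign, Finset.prod_filter, Fin.prod_univ_five]

theorem moveSign_three :
    moveSign p 3 = koszul (p 3) (p 0) * koszul (p 3) (p 1) * koszul (p 3) (p 2) := by
  simp [moveSign, Finset.prod_filter, Fin.prod_univ_five]

theorem moveSign_four : moveSign p 4 =
    koszul (p 4) (p 0) * koszul (p 4) (p 1) * koszul (p 4) (p 2) * koszul (p 4) (p 3) := by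
  simp [moveSign, Finset.prod_filter, Fin.prod_univ_five]

end

/-- Puts the arguments of a coboundary term into literal form; for concrete indices the hypothesis
is decidable. -/
theorem cons_removeNth_removeNth {α : Type*} (u : α) (X : Fin 5 → α) (i : Fin 4) (j a b c : Fin 5)
    (h : j.succAbove (i.succAbove 0) = a ∧ j.succAbove (i.succAbove 1) = b ∧
      j.succAbove (i.succAbove 2) = c) :
    (Fin.cons u (i.removeNth (j.removeNth X)) : Fin 4 → α) = ![u, X a, X b, X c] := by
  obtain ⟨rfl, rfl, rfl⟩ := h
  ext k
  fin_cases k <;> rfl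

/-- The coboundary of a four-cochain, written out. -/
theorem coboundary_four (ω : MultilinearMap ℝ (fun _ : Fin 4 => L) ℝ) (p : Fin 5 → ZMod 2)
    (X : Fin 5 → L) : coboundary ω p X =
      -(koszul (p 0) (p 1) * moveSign p 0 * moveSign p 1 *
        ω ![bracket (X 0) (X 1), X 2, X 3, X 4]) +
      koszul (p 0) (p 2) * moveSign p 0 * moveSign p 2 *
        ω ![bracket (X 0) (X 2), X 1, X 3, X 4] -
      koszul (p 0) (p 3) * moveSign p 0 * moveSign p 3 *
        ω ![bracket (X 0) (X 3), X 1, X 2, X 4] +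
      koszul (p 0) (p 4) * moveSign p 0 * moveSign p 4 *
        ω ![bracket (X 0) (X 4), X 1, X 2, X 3] -
      koszul (p 1) (p 2) * moveSign p 1 * moveSign p 2 *
        ω ![bracket (X 1) (X 2), X 0, X 3, X 4] +
      koszul (p 1) (p 3) * moveSign p 1 * moveSign p 3 *
        ω ![bracket (X 1) (X 3), X 0, X 2, X 4] -
      koszul (p 1) (p 4) * moveSign p 1 * moveSign p 4 *
        ω ![bracket (X 1) (X 4), X 0, X 2, X 3] -
      koszul (p 2) (p 3) * moveSign p 2 * moveSign p 3 *
        ω ![bracket (X 2) (X 3), X 0, X 1, X 4] +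
      koszul (p 2) (p 4) * moveSign p 2 * moveSign p 4 *
        ω ![bracket (X 2) (X 4), X 0, X 1, X 3] -
      koszul (p 3) (p 4) * moveSign p 3 * moveSign p 4 *
        ω ![bracket (X 3) (X 4), X 0, X 1, X 2] := by
  have e (i j a b c h) := fun u => cons_removeNth_removeNth u X i j a b c h
  simp only [coboundary, Nat.reduceAdd, Fin.sum_univ_five, Fin.sum_univ_four, Fin.isValue,
    Fin.reduceCastSucc, Fin.reduceLT, ↓reduceIte, e 0 1 2 3 4 (by decide),
    e 0 2 1 3 4 (by decide), e 0 3 1 2 4 (by decide), e 0 4 1 2 3 (by decide),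
    e 1 2 0 3 4 (by decide), e 1 3 0 2 4 (by decide), e 1 4 0 2 3 (by decide),
    e 2 3 0 1 4 (by decide), e 2 4 0 1 3 (by decide), e 3 4 0 1 2 (by decide)]
  norm_num
  ring

end

/-! ### The four-cocycle of the supertranslation algebra -/

section
variable {K : Type} [NormedDivisionAlgebra K]

theorem bracket_eq (x y : Supertranslation K) : bracket x y = (spinorDot x.2 y.2, 0) := rfl

theorem fst_or_snd_eq_zero {i : ZMod 2} {x : Supertranslation K} (hx : x ∈ part i) :
    i = 0 ∧ x.2 = 0 ∨ i = 1 ∧ x.1 = 0 := by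
  obtain rfl | rfl := parity_cases i
  · exact .inl ⟨rfl, mem_superPart_zero.1 hx⟩
  · exact .inr ⟨rfl, mem_superPart_one.1 hx⟩

variable (K) in
/-- The multilinear map underlying the four-cocycle: `⟨Ψ, (𝒜ℬ - ℬ𝒜) Φ⟩` summed over the shuffles. -/
def fourForm : MultilinearMap ℝ (fun _ : Fin 4 => Supertranslation K) ℝ :=
  MultilinearMap.mk' (fun X =>
    -- Exchanging a spinor with a vector costs -1, so each summand carries the sign of the shuffle
    -- that moves its two spinors to the front.
    commutatorForm K (X 0).2 (X 1).2 (X 2).1 (X 3).1 -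
    commutatorForm K (X 0).2 (X 2).2 (X 1).1 (X 3).1 +
    commutatorForm K (X 0).2 (X 3).2 (X 1).1 (X 2).1 +
    commutatorForm K (X 1).2 (X 2).2 (X 0).1 (X 3).1 -
    commutatorForm K (X 1).2 (X 3).2 (X 0).1 (X 2).1 +
    commutatorForm K (X 2).2 (X 3).2 (X 0).1 (X 1).1)
    (fun X i x y => by fin_cases i <;> simp [Function.update] <;> ring)
    (fun X i r x => by fin_cases i <;> simp [Function.update] <;> ring)

theorem fourForm_apply (X : Fin 4 → Supertranslation K) : fourForm K X =
    commutatorForm K (X 0).2 (X 1).2 (X 2).1 (X 3).1 -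
    commutatorForm K (X 0).2 (X 2).2 (X 1).1 (X 3).1 +
    commutatorForm K (X 0).2 (X 3).2 (X 1).1 (X 2).1 +
    commutatorForm K (X 1).2 (X 2).2 (X 0).1 (X 3).1 -
    commutatorForm K (X 1).2 (X 3).2 (X 0).1 (X 2).1 +
    commutatorForm K (X 2).2 (X 3).2 (X 0).1 (X 1).1 := rfl

variable (K) in
/-- The four-cocycle as a cochain of the supertranslation algebra. -/
def fourCochain : Cochain (Supertranslation K) 4 := ⟨fourForm K, fun p X hX i j hij => by
  have hX' := fun k => fst_or_snd_eq_zero (hX k)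
  have s (i j : Fin 4) (A B : Vectors K) := commutatorForm_swap_spinors (X i).2 (X j).2 A B
  have v (i j : Fin 4) (Ψ Φ : Spinors K) := commutatorForm_swap_vectors Ψ Φ (X i).1 (X j).1
  -- For equal parities the symmetry in the spinors or the skewness in the vectors applies; a mixed
  -- exchange permutes the surviving summands.
  obtain ⟨rfl, rfl⟩ | ⟨rfl, rfl⟩ | ⟨rfl, rfl⟩ :
      i = 0 ∧ j = 1 ∨ i = 1 ∧ j = 2 ∨ i = 2 ∧ j = 3 := by omega
  · rcases hX' 0 with ⟨h₀, h₀'⟩ | ⟨h₀, h₀'⟩ <;> rcases hX' 1 with ⟨h₁, h₁'⟩ | ⟨h₁, h₁'⟩ <;>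
      simp [fourForm_apply, Equiv.swap_apply_of_ne_of_ne, h₀, h₁, h₀', h₁', koszul_zero_left,
        koszul_zero_right, koszul_one_one, s 1 0, v 1 0] <;> ring
  · rcases hX' 1 with ⟨h₀, h₀'⟩ | ⟨h₀, h₀'⟩ <;> rcases hX' 2 with ⟨h₁, h₁'⟩ | ⟨h₁, h₁'⟩ <;>
      simp [fourForm_apply, Equiv.swap_apply_of_ne_of_ne, h₀, h₁, h₀', h₁', koszul_zero_left,
        koszul_zero_right, koszul_one_one, s 2 1, v 2 1] <;> ring
  · rcases hX' 2 with ⟨h₀, h₀'⟩ | ⟨h₀, h₀'⟩ <;> rcases hX' 3 with ⟨h₁, h₁'⟩ | ⟨h₁, h₁'⟩ <;>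
      simp [fourForm_apply, Equiv.swap_apply_of_ne_of_ne, h₀, h₁, h₀', h₁', koszul_zero_left,
        koszul_zero_right, koszul_one_one, s 3 2, v 3 2] <;> ring⟩

theorem isForm_fourCochain : IsForm 2 2 (fourCochain K) := by
  intro p X hX hp
  change fourForm K X = 0
  rw [fourForm_apply]
  have hX' := fun k => fst_or_snd_eq_zero (hX k)
  rw [Finset.card_filter] at hp
  replace hp := (Fin.sum_univ_four fun k => if p k = 1 then 1 else 0).symm.trans_ne hp
  rcases hX' 0 with ⟨h₀, h₀'⟩ | ⟨h₀, h₀'⟩ <;> rcases hX' 1 with ⟨h₁, h₁'⟩ | ⟨h₁, h₁'⟩ <;>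
    rcases hX' 2 with ⟨h₂, h₂'⟩ | ⟨h₂, h₂'⟩ <;> rcases hX' 3 with ⟨h₃, h₃'⟩ | ⟨h₃, h₃'⟩ <;>
    -- Either each of the six summands has a vanishing factor, or exactly two arguments are odd,
    -- against `hp`.
    first
    | (simp [h₀', h₁', h₂', h₃']; done)
    | simp [h₀, h₁, h₂, h₃] at hp

theorem fourCochain_apply (Ψ Φ : Spinors K) (A B : Vectors K) :
    (fourCochain K).1 ![(0, Ψ), (0, Φ), (A, 0), (B, 0)] = commutatorForm K Ψ Φ A B := by
  change fourForm K _ = _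
  simp [fourForm_apply]

theorem isForm_two_two_ext {ω η : Cochain (Supertranslation K) 4} (hω : IsForm 2 2 ω)
    (hη : IsForm 2 2 η) (h : ∀ (Ψ Φ : Spinors K) (A B : Vectors K),
      ω.1 ![(0, Ψ), (0, Φ), (A, 0), (B, 0)] = η.1 ![(0, Ψ), (0, Φ), (A, 0), (B, 0)]) : ω = η := by
  have hsub : IsForm 2 2 (ω - η) := fun p X hX hp => by
    change ω.1 X - η.1 X = 0
    rw [hω p X hX hp, hη p X hX hp, sub_zero]
  refine sub_eq_zero.1 (hsub.eq_zero fun X hX => ?_)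
  have hX' : X = ![(0, (X 0).2), (0, (X 1).2), ((X 2).1, 0), ((X 3).1, 0)] := by
    ext1 k
    fin_cases k
    · exact Prod.ext (mem_superPart_one.1 (hX 0)) rfl
    · exact Prod.ext (mem_superPart_one.1 (hX 1)) rfl
    · exact Prod.ext rfl (mem_superPart_zero.1 (hX 2))
    · exact Prod.ext rfl (mem_superPart_zero.1 (hX 3))
  change ω.1 X - η.1 X = 0
  rw [hX', h, sub_self]

theorem IsForm.isEven {ω : Cochain (Supertranslation K) 4} (hω : IsForm 2 2 ω) :
    IsEvenCochain ω := by
  intro p X hX hp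
  refine hω p X hX ?_
  exact (by decide : ∀ p : Fin 4 → ZMod 2, ∑ k, p k = 1 →
    (Finset.univ.filter fun k => p k = 1).card ≠ 2) p hp

set_option maxHeartbeats 2000000 in
theorem isClosed_fourCochain : IsClosedCochain (fourCochain K) := by
  intro p X hX
  have hX' := fun k => fst_or_snd_eq_zero (hX k)
  have e := commutatorForm_spinorDot_polarized (K := K)
  rw [coboundary_four]
  simp only [fourCochain, fourForm_apply, Matrix.cons_val, bracket_eq, map_zero, LinearMap.zero_apply,
    sub_zero, add_zero, zero_add, moveSign_zero, moveSign_one, moveSign_two,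
    moveSign_three, moveSign_four]
  rcases hX' 0 with ⟨h₀, h₀'⟩ | ⟨h₀, h₀'⟩ <;> rcases hX' 1 with ⟨h₁, h₁'⟩ | ⟨h₁, h₁'⟩ <;>
    rcases hX' 2 with ⟨h₂, h₂'⟩ | ⟨h₂, h₂'⟩ <;> rcases hX' 3 with ⟨h₃, h₃'⟩ | ⟨h₃, h₃'⟩ <;>
    rcases hX' 4 with ⟨h₄, h₄'⟩ | ⟨h₄, h₄'⟩ <;>
    simp only [h₀, h₁, h₂, h₃, h₄, h₀', h₁', h₂', h₃', h₄', koszul_zero_left, koszul_zero_right,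
      koszul_one_one, map_zero, LinearMap.zero_apply, mul_zero, add_zero, zero_add, sub_zero,
      zero_sub, neg_zero]
  -- Only the five parities with a single even argument survive; the sign alternates with the
  -- position of the vector.
  · linear_combination -e (X 1).2 (X 2).2 (X 3).2 (X 4).2 (X 0).1
  · linear_combination e (X 0).2 (X 2).2 (X 3).2 (X 4).2 (X 1).1
  · linear_combination -e (X 0).2 (X 1).2 (X 3).2 (X 4).2 (X 2).1
  · linear_combination e (X 0).2 (X 1).2 (X 2).2 (X 4).2 (X 3).1
  · linear_combination -e (X 0).2 (X 1).2 (X 2).2 (X 3).2 (X 4).1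

theorem not_isExact_fourCochain : ¬ IsExactCochain (fourCochain K) := by
  rintro ⟨θ, hθ⟩
  -- The only nonzero components of these spinors are never paired with each other in Ψ·Φ, which
  -- therefore vanishes. `A` and `B` are orthogonal spatial vectors with [𝒜, ℬ]Φ equal to twice the
  -- basis spinor at `.inr 0`, so that ⟨Ψ, [𝒜, ℬ]Φ⟩ = -2.
  let Ψ : Spinors K := Pi.single (.inl 0) 1
  let Φ : Spinors K := Pi.single (.inr 1) 1
  let A : Vectors K := vec 0 0 1 0
  let B : Vectors K := vec 0 0 0 1
  have hd : spinorDot Ψ Φ = 0 := by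
    refine metric_separatingLeft _ fun M => ?_
    obtain ⟨a, t, x, y, rfl⟩ := exists_vec M
    rw [metric_spinorDot, spinorForm_gamma_vec]
    simp [Ψ, Φ]
  have h := hθ ![1, 1, 0, 0] ![(0, Ψ), (0, Φ), (A, 0), (B, 0)] fun k => by
    fin_cases k
    · exact mem_superPart_one.2 rfl
    · exact mem_superPart_one.2 rfl
    · exact mem_superPart_zero.2 rfl
    · exact mem_superPart_zero.2 rfl
  rw [fourCochain_apply, coboundary_eq_zero_of_bracket, commutatorForm_apply, map_sub,
    spinorForm_gamma_vec, spinorForm_gamma_vec] at h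
  · simp [Ψ, Φ, A, B, gamma_apply, vec, blockMatrix, traceReversal, Matrix.trace_fin_two, Matrix.mulVec, dotProduct,
      Pi.single_apply, re_one] at h
    norm_num at h
  · intro i j hij
    rw [bracket_eq]
    fin_cases i <;> fin_cases j <;> first | exact absurd hij (by decide) | simp [hd]

end

end SuperMinkowski

theorem mainTheorem3 (D : ℕ) (K : Type) [NormedDivisionAlgebra K] (hK : IsSpacetimeAlgebra D K) :
    Module.finrank ℝ (Vectors K) = D ∧
    ∃ β : Cochain (Supertranslation K) 4,
      (IsForm 2 2 β ∧ ∀ (Ψ Φ : Spinors K) (A B : Vectors K),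
        β.1 ![(0, Ψ), (0, Φ), (A, 0), (B, 0)] =
          spinorForm Ψ (cliffordAction (cliffordCommutator A B) Φ)) ∧
      (∀ γ : Cochain (Supertranslation K) 4,
        (IsForm 2 2 γ ∧ ∀ (Ψ Φ : Spinors K) (A B : Vectors K),
          γ.1 ![(0, Ψ), (0, Φ), (A, 0), (B, 0)] =
            spinorForm Ψ (cliffordAction (cliffordCommutator A B) Φ)) → γ = β) ∧
      IsEvenCochain β ∧ IsClosedCochain β ∧ ¬ IsExactCochain β := by
  refine ⟨hK.finrank_vectors, fourCochain K, ⟨isForm_fourCochain, fun Ψ Φ A B => ?_⟩, ?_,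
    isForm_fourCochain.isEven, isClosed_fourCochain, not_isExact_fourCochain⟩
  · rw [fourCochain_apply, spinorForm_cliffordCommutator]
  · rintro γ ⟨hγ, hγ'⟩
    exact isForm_two_two_ext hγ isForm_fourCochain fun Ψ Φ A B => by
      rw [hγ', fourCochain_apply, spinorForm_cliffordCommutator]
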